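/- **Setting.** Let $X$ be equiprobable on $\{-1,+1\}$ and let $Y$ be the real output of a symmetric channel with transition densities $\mathbb P_{Y|X}(y|x)$, $\mathbb P_{Y|X}(y|-x)=\mathbb P_{Y|X}(-y|x)$. Write $\mathbb P_{X,Y}(x,y)=\tfrac12\mathbb P_{Y|X}(y|x)$ and $\ell(y)=\log\mathbb P_{X|Y}(1|y)-\log\mathbb P_{X|Y}(-1|y)\in[-\infty,\infty]$ for the log-likelihood ratio (LLR), and assume that $|\ell(Y)|$ has a continuous distribution (no atoms in $[0,\infty]$). Let $(X_1,Y_1),\dots,(X_n,Y_n)$ be i.i.d. copies of $(X,Y)$, and let $(\widetilde X_i,\widetilde Y_i)_{i=1}^n$ be these pairs rearranged so that $|\widetilde L_1|\ge\dots\ge|\widetilde L_n|$, where $\widetilde L_i=\ell(\widetilde Y_i)$; put $|\widetilde L_0|=\infty$ and $|\widetilde L_{n+1}|=0$. Let $1\le a\le b\le n$ and $m=b-a+1$. For $u,v\in[0,\infty]$ let $\mathcal Y_{u,v}=\mathcal Y^{(+)}_{u,v}\cup\mathcal Y^{(-)}_{u,v}$ with $$\mathcal Y^{(+)}_{u,v}=\{y: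 e^{-u}+1\le \mathbb P_{X|Y}(1|y)^{-1}\le e^{-v}+1\},\qquad \mathcal Y^{(-)}_{u,v}=\{y: e^{v}+1\le \mathbb P_{X|Y}(1|y)^{-1}\le e^{u}+1\},$$ that is, the band $v\le|\ell(y)|\le u$. Let $(\hat X,\hat Y)$ have the joint density $$\mathbb P_{\hat X,\hat Y}(x,y)=\frac12\cdot\frac{\mathbb P_{X,Y}(x,y)}{\int_{\mathcal Y_{u,v}}\mathbb P_{X,Y}(x,y')\,dy'},\qquad x\in\{-1,1\},\ y\in\mathcal Y_{u,v},$$ and let $(\hat X_a^b,\hat Y_a^b)$ be $m$ i.i.d. copies of $(\hat X,\hat Y)$. A guess strategy is a measurable function $G(x|y)$ of $x\in\{-1,1\}^m$ and $y\in\mathbb R^m$ such that for each $y$ the map $x\mapsto G(x|y)$ is a bijection onto $\{1,\dots,2^m\}$. It is permutation invariant if $G(\pi(x)|\pi(y))=G(x|y)$ for all permutations $\pi$ of the $m$ positions, all $x$, and all $y$ for which $|\ell(y_1)|,\dots,|\ell(y_m)|$ are distinct. It is optimal if $G(x|y)<G(x'|y)$ whenever $\prod_i\mathbb P_{X|Y}(x_i|y_i)>\prod_i\mathbb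 P_{X|Y}(x'_i|y_i)$. **Lemma.** For almost every value $(u,v)$ of $(|\widetilde L_{a-1}|,|\widetilde L_{b+1}|)$ the law of $(\hat X,\hat Y)$ is a probability distribution, and for every guess strategy $G$ that is permutation invariant or optimal and every $\omega\in\mathbb R$, $$\mathbb E\big[G(\hat X_a^b|\hat Y_a^b)^\omega\big]=\mathbb E\big[G(\widetilde X_a^b|\widetilde Y_a^b)^\omega\,\big|\,|\widetilde L_{a-1}|=u,\ |\widetilde L_{b+1}|=v\big],$$ where the right side is taken with respect to the regular conditional distribution of $(\widetilde X_a^b,\widetilde Y_a^b)$ given $(|\widetilde L_{a-1}|,|\widetilde L_{b+1}|)$. -/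

import Mathlib

open MeasureTheory ProbabilityTheory
open scoped ENNReal NNReal

noncomputable section

instance discreteMeasurableSpaceInput : DiscreteMeasurableSpace ℤˣ :=
  ⟨fun s => ⟨Units.val '' s, trivial, Set.preimage_image_eq s Units.val_injective⟩⟩

/-- A binary-input symmetric channel with real output. The input alphabet `{-1, +1}` is `ℤˣ`, and
`pdf x y` is the transition density `P_{Y|X}(y|x)` with respect to Lebesgue measure. -/
structure SymmetricChannel where
  pdf : ℤˣ → ℝ → ℝ≥0
  measurable_pdf : ∀ x, Measurable (pdf x)
  lintegral_pdf : ∀ x, ∫⁻ y, (pdf x y : ℝ≥0∞) = 1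
  symm : ∀ x y, pdf (-x) y = pdf x (-y)

namespace SymmetricChannel

/-- The joint density `P_{X,Y}(x,y)` for an equiprobable input. -/
def jointPdf (W : SymmetricChannel) (x : ℤˣ) (y : ℝ) : ℝ≥0∞ := W.pdf x y / 2

/-- The law of the pair `(X, Y)`. -/
def jointLaw (W : SymmetricChannel) : Measure (ℤˣ × ℝ) :=
  ((Measure.count : Measure ℤˣ).prod (volume : Measure ℝ)).withDensity
    fun p => W.jointPdf p.1 p.2

/-- The posterior probability `P_{X|Y}(x|y)`. -/
def post (W : SymmetricChannel) (x : ℤˣ) (y : ℝ) : ℝ≥0∞ :=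
  W.jointPdf x y / ∑ x' : ℤˣ, W.jointPdf x' y

/-- The log-likelihood ratio `log P_{X|Y}(1|y) - log P_{X|Y}(-1|y)`, with values in `[-∞, ∞]`. -/
def llr (W : SymmetricChannel) (y : ℝ) : EReal :=
  ENNReal.log (W.post 1 y) - ENNReal.log (W.post (-1) y)

/-- The LLR magnitude, with values in `[0, ∞]`. -/
def absLLR (W : SymmetricChannel) (y : ℝ) : ℝ≥0∞ := (W.llr y).abs

/-- The LLR magnitude `|L|` has a continuous distribution: no value in `[0, ∞]` is an atom. -/
def ContinuousLLR (W : SymmetricChannel) : Prop :=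
  ∀ c : ℝ≥0∞, W.jointLaw {p | W.absLLR p.2 = c} = 0

/-- The permutation that lists the positions in descending order of LLR magnitude: the entry at
ordered position `i + 1` is the one with index `W.order y i`. -/
def order (W : SymmetricChannel) {n : ℕ} (y : Fin n → ℝ) : Equiv.Perm (Fin n) :=
  Tuple.sort fun i => OrderDual.toDual (W.absLLR (y i))

/-- The LLR magnitude at ordered position `i`, where the positions are `1, …, n`, extended by
`∞` at position `0` and by `0` at position `n + 1`. -/
def orderedAbsLLR (W : SymmetricChannel) {n : ℕ} (y : Fin n → ℝ) (i : ℕ) : ℝ≥0∞ :=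
  if i = 0 then ⊤
  else if h : i - 1 < n then W.absLLR (y (W.order y ⟨i - 1, h⟩))
  else 0

/-- The pairs at the ordered positions `a, a + 1, …, b`. -/
def orderedSegment (W : SymmetricChannel) {n a b : ℕ} (ha : 1 ≤ a) (hb : b ≤ n)
    (p : Fin n → ℤˣ × ℝ) : Fin (b + 1 - a) → ℤˣ × ℝ :=
  fun j => p (W.order (fun i => (p i).2) ⟨a - 1 + j, by omega⟩)

/-- The positive-LLR part of the reliability band with upper end `u` and lower end `v`. -/
def bandPos (W : SymmetricChannel) (u v : ℝ≥0∞) : Set ℝ :=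
  {y | EReal.exp (-(u : EReal)) + 1 ≤ (W.post 1 y)⁻¹ ∧
    (W.post 1 y)⁻¹ ≤ EReal.exp (-(v : EReal)) + 1}

/-- The negative-LLR part of the reliability band with upper end `u` and lower end `v`. -/
def bandNeg (W : SymmetricChannel) (u v : ℝ≥0∞) : Set ℝ :=
  {y | EReal.exp (v : EReal) + 1 ≤ (W.post 1 y)⁻¹ ∧
    (W.post 1 y)⁻¹ ≤ EReal.exp (u : EReal) + 1}

/-- The reliability band `v ≤ |LLR| ≤ u`. -/
def band (W : SymmetricChannel) (u v : ℝ≥0∞) : Set ℝ := W.bandPos u v ∪ W.bandNeg u v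

/-- The law of the truncated pair `(X̂, Ŷ)`: `X̂` is equiprobable, and given `X̂ = x` the density
of `Ŷ` is `P_{X,Y}(x, ·)` restricted to the band and normalized. -/
def truncatedLaw (W : SymmetricChannel) (u v : ℝ≥0∞) : Measure (ℤˣ × ℝ) :=
  ((Measure.count : Measure ℤˣ).prod (volume : Measure ℝ)).withDensity fun p =>
    (W.band u v).indicator
      (fun y => (1 / 2) * (W.jointPdf p.1 y / ∫⁻ y' in W.band u v, W.jointPdf p.1 y')) p.2

end SymmetricChannel

/-- A guessing strategy for `x ∈ {-1, +1}^m` given `y ∈ ℝ^m`: `G x y` is the number of attempts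
up to and including the correct guess when the sequences are tried one after the other, in an
order that depends on `y`. -/
structure IsGuesswork {m : ℕ} (G : (Fin m → ℤˣ) → (Fin m → ℝ) → ℕ) : Prop where
  measurable : ∀ x, Measurable (G x)
  bijOn : ∀ y, Set.BijOn (fun x => G x y) Set.univ (Set.Icc 1 (2 ^ m))

/-- The guesswork does not change when the same permutation is applied to the guessed and to the
observed sequence. This is asked only where the LLR magnitudes are pairwise distinct: at `y` with
two equal entries no injective `G` could satisfy it. -/
def IsPermInvariant (W : SymmetricChannel) {m : ℕ}
    (G : (Fin m → ℤˣ) → (Fin m → ℝ) → ℕ) : Prop :=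
  ∀ (x : Fin m → ℤˣ) (y : Fin m → ℝ) (π : Equiv.Perm (Fin m)),
    Function.Injective (fun i => W.absLLR (y i)) →
      G (fun i => x (π i)) (fun i => y (π i)) = G x y

/-- The optimal strategy: guess in decreasing order of the posterior probability
`∏ i, P_{X|Y}(x_i|y_i)`, with ties broken in any way. -/
def IsOptimal (W : SymmetricChannel) {m : ℕ}
    (G : (Fin m → ℤˣ) → (Fin m → ℝ) → ℕ) : Prop :=
  ∀ (x x' : Fin m → ℤˣ) (y : Fin m → ℝ),
    ∏ i, W.post (x' i) (y i) < ∏ i, W.post (x i) (y i) → G x y < G x' y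

/-- The `ω`-th moment of the guesswork when the pairs have joint law `ν`. -/
def guessMoment {m : ℕ} (G : (Fin m → ℤˣ) → (Fin m → ℝ) → ℕ) (ω : ℝ)
    (ν : Measure (Fin m → ℤˣ × ℝ)) : ℝ :=
  ∫ p, (G (fun i => (p i).1) (fun i => (p i).2) : ℝ) ^ ω ∂ν

end

/-! Write `P_k` for the law of `k` independent pairs. Ties in LLR magnitude have probability zero,
so each of the `n!` possible orders contributes equally, and sorting turns `P_n` into `n!` times its
restriction to descending sequences (`map_descSort`). Split a sequence into the segment and the
outside entries: it descends iff both parts do and the segment lies in the band cut out by its two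
neighbours (`glueSegment_mem_descending`). Hence, by Fubini, the segment given the boundary `(u, v)`
has law `P_m` conditioned on descending sequences in the band (`segmentKernel`,
`condDistrib_orderedSegment`).

Channel symmetry gives both inputs the same band mass, so `truncatedLaw` is the law of `(X, Y)`
conditioned on the band, and its `m`-fold product is `P_m` conditioned on the band box. The two laws
differ only by the restriction to descending sequences. It remains to see that the integral of `G ^
ω` over the box is `m!` times that over its descending part (`setLIntegral_guesswork`).

For permutation invariant `G` this is symmetry. An optimal `G` may break ties asymmetrically, but
the posterior mean of `G ^ ω` given the outputs depends only on the sorted list of posterior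
weights, hence is symmetric (`postMean_comp_perm`). Box and ordering depend on outputs only, so the
mean may replace `G ^ ω`. -/

noncomputable section

/-! ### Extended-real absolute values and sums over the input alphabet. -/

theorem EReal.coe_abs_eq_max (l : EReal) : ((l.abs : ℝ≥0∞) : EReal) = max l (-l) := by
  induction l with
  | bot => simp
  | top => simp
  | coe x =>
    rw [EReal.coe_abs, ← EReal.coe_neg, abs, ← EReal.coe_strictMono.monotone.map_max]

theorem EReal.abs_eq_toENNReal (l : EReal) : l.abs = (max l (-l)).toENNReal := by
  rw [← EReal.coe_abs_eq_max, EReal.toENNReal_coe]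

theorem EReal.measurable_abs : Measurable EReal.abs := by
  have : EReal.abs = fun l => (max l (-l)).toENNReal := funext EReal.abs_eq_toENNReal
  rw [this]
  exact measurable_ereal_toENNReal.comp (measurable_id.max measurable_neg)

theorem EReal.le_abs_and_abs_le_iff (l : EReal) (u v : ℝ≥0∞) :
    (v ≤ l.abs ∧ l.abs ≤ u) ↔
      ((v : EReal) ≤ l ∧ l ≤ u) ∨ ((v : EReal) ≤ -l ∧ -l ≤ u) := by
  rw [← EReal.coe_ennreal_le_coe_ennreal_iff, ← EReal.coe_ennreal_le_coe_ennreal_iff,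
    EReal.coe_abs_eq_max]
  have hv : (0 : EReal) ≤ v := EReal.coe_ennreal_nonneg v
  constructor
  · rintro ⟨h1, h2⟩
    rcases le_max_iff.1 h1 with h | h
    · exact Or.inl ⟨h, (le_max_left _ _).trans h2⟩
    · exact Or.inr ⟨h, (le_max_right _ _).trans h2⟩
  · rintro (⟨h1, h2⟩ | ⟨h1, h2⟩)
    · have : -l ≤ 0 := by simpa using hv.trans h1
      exact ⟨h1.trans (le_max_left _ _), max_le h2 (this.trans ((hv.trans h1).trans h2))⟩
    · have : l ≤ 0 := by simpa using EReal.neg_le_neg_iff.2 (hv.trans h1)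
      exact ⟨h1.trans (le_max_right _ _), max_le (this.trans ((hv.trans h1).trans h2)) h2⟩

theorem sum_intUnits {M : Type*} [AddCommMonoid M] (f : ℤˣ → M) : ∑ x, f x = f 1 + f (-1) := by
  have : (Finset.univ : Finset ℤˣ) = {1, -1} := rfl
  rw [this, Finset.sum_pair (by decide)]

theorem lintegral_count_intUnits_prod (F : ℤˣ × ℝ → ℝ≥0∞) (hF : Measurable F) :
    ∫⁻ p, F p ∂((Measure.count : Measure ℤˣ).prod (volume : Measure ℝ)) =
      ∑ x, ∫⁻ y, F (x, y) := by
  rw [lintegral_prod _ hF.aemeasurable, lintegral_count, tsum_fintype]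

/-! ### Posteriors, the reliability band and the truncated law. -/

namespace SymmetricChannel

variable (W : SymmetricChannel)

theorem measurable_jointPdf (x : ℤˣ) : Measurable (W.jointPdf x) :=
  (W.measurable_pdf x).coe_nnreal_ennreal.div_const 2

theorem measurable_post (x : ℤˣ) : Measurable (W.post x) :=
  (W.measurable_jointPdf x).div (Finset.measurable_fun_sum _ fun x _ => W.measurable_jointPdf x)

theorem measurable_absLLR : Measurable W.absLLR := by
  refine EReal.measurable_abs.comp ?_
  exact (W.measurable_post 1).ennreal_log.sub (W.measurable_post (-1)).ennreal_log

theorem jointPdf_ne_top (x : ℤˣ) (y : ℝ) : W.jointPdf x y ≠ ⊤ :=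
  ENNReal.div_ne_top ENNReal.coe_ne_top two_ne_zero

theorem sum_jointPdf_ne_top (y : ℝ) : ∑ x, W.jointPdf x y ≠ ⊤ :=
  ENNReal.sum_ne_top.2 fun x _ => W.jointPdf_ne_top x y

theorem post_mul_sum_jointPdf (x : ℤˣ) (y : ℝ) :
    W.post x y * ∑ x', W.jointPdf x' y = W.jointPdf x y := by
  rcases eq_or_ne (∑ x', W.jointPdf x' y) 0 with h | h
  · rw [h, mul_zero]
    exact ((Finset.sum_eq_zero_iff.1 h) x (Finset.mem_univ x)).symm
  · exact ENNReal.div_mul_cancel h (W.sum_jointPdf_ne_top y)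

/-- Either both posterior probabilities are the junk value `0`, or they add up to `1`. -/
theorem post_eq_zero_or_add_eq_one (y : ℝ) :
    (∀ x, W.post x y = 0) ∨ W.post 1 y + W.post (-1) y = 1 := by
  rcases eq_or_ne (∑ x', W.jointPdf x' y) 0 with h | h
  · left
    intro x
    have := (Finset.sum_eq_zero_iff.1 h) x (Finset.mem_univ x)
    rw [post, this, ENNReal.zero_div]
  · right
    rw [post, post, ← ENNReal.add_div, ← sum_intUnits fun x => W.jointPdf x y]
    exact ENNReal.div_self h (W.sum_jointPdf_ne_top y)

theorem sum_post_eq_zero_or_one (y : ℝ) : ∑ x, W.post x y = 0 ∨ ∑ x, W.post x y = 1 := by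
  rw [sum_intUnits fun x => W.post x y]
  refine (W.post_eq_zero_or_add_eq_one y).imp (fun h => ?_) id
  rw [h, h, add_zero]

theorem jointPdf_neg (x : ℤˣ) (y : ℝ) : W.jointPdf x (-y) = W.jointPdf (-x) y := by
  rw [jointPdf, jointPdf, W.symm]

theorem post_neg (x : ℤˣ) (y : ℝ) : W.post x (-y) = W.post (-x) y := by
  simp only [post, jointPdf_neg]
  congr 1
  exact Equiv.sum_comp (Equiv.neg ℤˣ) fun x => W.jointPdf x y

/-- Reflecting the output swaps the two posteriors and so flips the sign of the LLR. -/
theorem absLLR_neg (y : ℝ) : W.absLLR (-y) = W.absLLR y := by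
  simp only [absLLR, llr, post_neg, neg_neg]
  rcases W.post_eq_zero_or_add_eq_one y with h | h
  · simp [h]
  · have h1 : W.post 1 y ≠ ⊤ := fun h' => by simp [h'] at h
    have h2 : W.post (-1) y ≠ ⊤ := fun h' => by simp [h'] at h
    -- The split shows that the two logarithms are not both `⊥`, as negating their difference
    -- requires.
    rcases eq_or_ne (W.post 1 y) 0 with h0 | h0
    · rw [← EReal.abs_neg, EReal.neg_sub (by simp_all) (by simp_all), add_comm, ← sub_eq_add_neg]
    · rw [← EReal.abs_neg, EReal.neg_sub (by simp_all) (by simp_all), add_comm, ← sub_eq_add_neg]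

/-- For `p = P(1|y)` this is `1 / p = (1 - p) / p + 1`. It also holds at outputs of zero density:
there `llr` is `⊥ - ⊥ = ⊥` and both sides are `⊤`. -/
theorem inv_post_one (y : ℝ) : (W.post 1 y)⁻¹ = EReal.exp (-W.llr y) + 1 := by
  rw [llr]
  rcases W.post_eq_zero_or_add_eq_one y with h | h
  · simp [h]
  have h1 : W.post 1 y ≠ ⊤ := fun h' => by simp [h'] at h
  have h2 : W.post (-1) y ≠ ⊤ := fun h' => by simp [h'] at h
  rcases eq_or_ne (W.post 1 y) 0 with h0 | h0
  · have : W.post (-1) y = 1 := by simpa [h0] using h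
    simp [h0, this]
  · rw [EReal.neg_sub (by simp_all) (by simp_all), ← ENNReal.log_inv, ← ENNReal.log_mul_add,
      ENNReal.exp_log]
    nth_rw 1 [← mul_one (W.post 1 y)⁻¹, ← h, mul_add, ENNReal.inv_mul_cancel h0 h1, add_comm]

theorem band_eq (u v : ℝ≥0∞) : W.band u v = {y | v ≤ W.absLLR y ∧ W.absLLR y ≤ u} := by
  have key : ∀ s t : EReal, EReal.exp s + 1 ≤ EReal.exp t + 1 ↔ s ≤ t := fun s t => by
    rw [ENNReal.add_le_add_iff_right ENNReal.one_ne_top]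
    exact EReal.expOrderIso.le_iff_le
  ext y
  simp only [band, bandPos, bandNeg, Set.mem_union, Set.mem_ofPred_eq, inv_post_one, key, absLLR,
    EReal.le_abs_and_abs_le_iff, EReal.neg_le_neg_iff]
  tauto

theorem measurableSet_band (u v : ℝ≥0∞) : MeasurableSet (W.band u v) := by
  rw [band_eq]
  exact (measurableSet_le measurable_const W.measurable_absLLR).inter
    (measurableSet_le W.measurable_absLLR measurable_const)

/-- The reflection `y ↦ -y` preserves Lebesgue measure and the band, and exchanges the two input
densities. -/
theorem lintegral_band_jointPdf_neg (u v : ℝ≥0∞) (x : ℤˣ) :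
    ∫⁻ y in W.band u v, W.jointPdf (-x) y = ∫⁻ y in W.band u v, W.jointPdf x y := by
  have hb : Neg.neg ⁻¹' W.band u v = W.band u v := by
    ext y
    simp [band_eq, absLLR_neg]
  have := (Measure.measurePreserving_neg (volume : Measure ℝ)).setLIntegral_comp_preimage
    (W.measurableSet_band u v) (W.measurable_jointPdf x)
  rw [hb] at this
  simpa only [jointPdf_neg] using this

theorem lintegral_band_jointPdf (u v : ℝ≥0∞) (x : ℤˣ) :
    ∫⁻ y in W.band u v, W.jointPdf x y = ∫⁻ y in W.band u v, W.jointPdf 1 y := by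
  rcases Int.units_eq_one_or x with rfl | rfl
  · rfl
  · exact W.lintegral_band_jointPdf_neg u v 1

theorem measurable_uncurry_jointPdf :
    Measurable fun p : ℤˣ × ℝ => W.jointPdf p.1 p.2 :=
  measurable_from_prod_countable_right W.measurable_jointPdf

theorem jointLaw_snd_preimage {s : Set ℝ} (hs : MeasurableSet s) :
    W.jointLaw (Prod.snd ⁻¹' s) = ∑ x, ∫⁻ y in s, W.jointPdf x y := by
  rw [jointLaw, withDensity_apply _ (measurable_snd hs), ← lintegral_indicator (measurable_snd hs),
    lintegral_count_intUnits_prod _ (W.measurable_uncurry_jointPdf.indicator (measurable_snd hs))]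
  refine Finset.sum_congr rfl fun x _ => ?_
  rw [← lintegral_indicator hs]
  rfl

instance isProbabilityMeasure_jointLaw : IsProbabilityMeasure W.jointLaw := by
  refine ⟨?_⟩
  rw [← Set.preimage_univ (f := Prod.snd), W.jointLaw_snd_preimage .univ, sum_intUnits]
  simp only [Measure.restrict_univ, jointPdf, div_eq_mul_inv]
  rw [lintegral_mul_const _ (W.measurable_pdf _).coe_nnreal_ennreal,
    lintegral_mul_const _ (W.measurable_pdf _).coe_nnreal_ennreal,
    W.lintegral_pdf, W.lintegral_pdf, one_mul, ENNReal.inv_two_add_inv_two]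

/-- The probability that the LLR magnitude lies between `v` and `u`. -/
def bandMass (u v : ℝ≥0∞) : ℝ≥0∞ := W.jointLaw (Prod.snd ⁻¹' W.band u v)

theorem bandMass_eq (u v : ℝ≥0∞) :
    W.bandMass u v = 2 * ∫⁻ y in W.band u v, W.jointPdf 1 y := by
  rw [bandMass, W.jointLaw_snd_preimage (W.measurableSet_band u v), sum_intUnits,
    lintegral_band_jointPdf_neg, two_mul]

theorem bandMass_ne_top (u v : ℝ≥0∞) : W.bandMass u v ≠ ⊤ := measure_ne_top _ _

/-- Each input has half of the band mass, so the factor `1 / 2` turns normalization per input into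
conditioning the pair on the band. -/
theorem truncatedLaw_eq (u v : ℝ≥0∞) :
    W.truncatedLaw u v =
      (W.bandMass u v)⁻¹ • W.jointLaw.restrict (Prod.snd ⁻¹' W.band u v) := by
  have hm : MeasurableSet (Prod.snd ⁻¹' W.band u v : Set (ℤˣ × ℝ)) :=
    measurable_snd (W.measurableSet_band u v)
  rw [truncatedLaw, jointLaw, restrict_withDensity hm, ← withDensity_indicator hm,
    ← withDensity_smul _ (W.measurable_uncurry_jointPdf.indicator hm)]
  congr 1
  ext ⟨x, y⟩
  simp only [Pi.smul_apply, smul_eq_mul, W.lintegral_band_jointPdf u v x]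
  by_cases hy : y ∈ W.band u v
  · have hp : (x, y) ∈ (Prod.snd ⁻¹' W.band u v : Set (ℤˣ × ℝ)) := hy
    rw [Set.indicator_of_mem hy, Set.indicator_of_mem hp, W.bandMass_eq,
      ENNReal.mul_inv (Or.inl two_ne_zero) (Or.inl ENNReal.ofNat_ne_top), div_eq_mul_inv,
      div_eq_mul_inv, one_mul, mul_comm (W.jointPdf x y), mul_assoc]
  · have hp : (x, y) ∉ (Prod.snd ⁻¹' W.band u v : Set (ℤˣ × ℝ)) := hy
    rw [Set.indicator_of_notMem hy, Set.indicator_of_notMem hp, mul_zero]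

theorem isProbabilityMeasure_truncatedLaw {u v : ℝ≥0∞} (h : W.bandMass u v ≠ 0) :
    IsProbabilityMeasure (W.truncatedLaw u v) := by
  refine ⟨?_⟩
  rw [W.truncatedLaw_eq, Measure.smul_apply, Measure.restrict_apply_univ, smul_eq_mul]
  exact ENNReal.inv_mul_cancel h (W.bandMass_ne_top u v)

end SymmetricChannel

/-! ### Sorting independent pairs by LLR magnitude. -/

theorem MeasureTheory.measurePreserving_comp_perm {ι E : Type*} [Fintype ι] [MeasurableSpace E]
    (ρ : Measure E) [SigmaFinite ρ] (σ : Equiv.Perm ι) :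
    MeasurePreserving (fun p : ι → E => fun i => p (σ i)) (Measure.pi fun _ => ρ)
      (Measure.pi fun _ => ρ) := by
  have h := measurePreserving_piCongrLeft (fun _ : ι => ρ) σ.symm
  convert h using 1
  ext p i
  rw [MeasurableEquiv.coe_piCongrLeft, Equiv.piCongrLeft_apply]
  simp

namespace SymmetricChannel

variable (W : SymmetricChannel)

/-- The sequences of pairs whose LLR magnitudes do not increase. -/
def descending (ι : Type*) [Preorder ι] : Set (ι → ℤˣ × ℝ) :=
  {p | Antitone fun i => W.absLLR (p i).2}

/-- The pairs listed in descending order of LLR magnitude. -/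
def descSort {n : ℕ} (p : Fin n → ℤˣ × ℝ) : Fin n → ℤˣ × ℝ :=
  fun i => p (W.order (fun i => (p i).2) i)

theorem measurable_absLLR_apply {ι : Type*} (i : ι) :
    Measurable fun p : ι → ℤˣ × ℝ => W.absLLR (p i).2 :=
  W.measurable_absLLR.comp (measurable_snd.comp (measurable_pi_apply i))

theorem measurableSet_descending (ι : Type*) [Preorder ι] [Countable ι] :
    MeasurableSet (W.descending ι) := by
  have : W.descending ι = ⋂ (i : ι) (j : ι) (_ : i ≤ j),
      {p | W.absLLR (p j).2 ≤ W.absLLR (p i).2} := by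
    ext p
    simp only [Set.mem_iInter]
    exact Iff.rfl
  rw [this]
  exact .iInter fun i => .iInter fun j => .iInter fun _ =>
    measurableSet_le (W.measurable_absLLR_apply j) (W.measurable_absLLR_apply i)

/-- `Tuple.sort` breaks ties by index; spelling this out exhibits the events of a given order as
measurable sets. -/
theorem order_eq_iff {n : ℕ} (y : Fin n → ℝ) (σ : Equiv.Perm (Fin n)) :
    W.order y = σ ↔ (Antitone fun i => W.absLLR (y (σ i))) ∧
      ∀ i j, i < j → W.absLLR (y (σ i)) = W.absLLR (y (σ j)) → σ i < σ j := by
  rw [order, eq_comm, Tuple.eq_sort_iff]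
  rfl

theorem measurableSet_order_eq {n : ℕ} (σ : Equiv.Perm (Fin n)) :
    MeasurableSet {p : Fin n → ℤˣ × ℝ | W.order (fun i => (p i).2) = σ} := by
  have : {p : Fin n → ℤˣ × ℝ | W.order (fun i => (p i).2) = σ} =
      ((fun p : Fin n → ℤˣ × ℝ => fun i => p (σ i)) ⁻¹' W.descending (Fin n)) ∩
      ⋂ (i : Fin n) (j : Fin n) (_ : i < j) (_ : ¬ σ i < σ j),
        {p | W.absLLR (p (σ i)).2 = W.absLLR (p (σ j)).2}ᶜ := by
    ext p
    simp only [Set.mem_ofPred_eq, Set.mem_inter_iff, Set.mem_iInter, order_eq_iff]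
    refine and_congr Iff.rfl (forall_congr' fun i => forall_congr' fun j => ?_)
    rw [Set.mem_compl_iff]
    simp only [Set.mem_ofPred_eq]
    tauto
  rw [this]
  refine MeasurableSet.inter ?_ ?_
  · exact measurable_pi_lambda _ (fun i => measurable_pi_apply _)
      (W.measurableSet_descending (Fin n))
  · exact .iInter fun i => .iInter fun j => .iInter fun _ => .iInter fun _ =>
      (measurableSet_eq_fun (W.measurable_absLLR_apply _) (W.measurable_absLLR_apply _)).compl

theorem descSort_preimage {n : ℕ} (s : Set (Fin n → ℤˣ × ℝ)) :
    W.descSort ⁻¹' s = ⋃ σ : Equiv.Perm (Fin n),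
      {p | W.order (fun i => (p i).2) = σ} ∩ (fun p i => p (σ i)) ⁻¹' s := by
  ext p
  simp only [Set.mem_preimage, Set.mem_iUnion, Set.mem_inter_iff, Set.mem_ofPred_eq,
    exists_eq_left']
  rfl

theorem measurable_descSort {n : ℕ} : Measurable (W.descSort (n := n)) := by
  intro s hs
  rw [descSort_preimage]
  exact .iUnion fun σ => (W.measurableSet_order_eq σ).inter
    (measurable_pi_lambda _ (fun i => measurable_pi_apply _) hs)

variable {W} in
-- Two positions are independent, so by Fubini the probability of a tie is an average of atoms of
-- the law of the LLR magnitude, all of which vanish.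
theorem ContinuousLLR.ae_injective (hW : W.ContinuousLLR) (n : ℕ) :
    ∀ᵐ p ∂(Measure.pi fun _ : Fin n => W.jointLaw),
      Function.Injective fun i => W.absLLR (p i).2 := by
  have hpair : ∀ i j : Fin n, i ≠ j → ∀ᵐ p ∂(Measure.pi fun _ : Fin n => W.jointLaw),
      W.absLLR (p i).2 ≠ W.absLLR (p j).2 := by
    intro i j hij
    have hind := (iIndepFun_pi (μ := fun _ : Fin n => W.jointLaw) (X := fun _ p => p)
      fun _ => aemeasurable_id).indepFun hij
    have hi := measurePreserving_eval (fun _ : Fin n => W.jointLaw) i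
    have hj := measurePreserving_eval (fun _ : Fin n => W.jointLaw) j
    have hmap := (indepFun_iff_map_prod_eq_prod_map_map hi.measurable.aemeasurable
      hj.measurable.aemeasurable).1 hind
    have hi' : (Measure.pi fun _ : Fin n => W.jointLaw).map (fun p => p i) = W.jointLaw :=
      hi.map_eq
    have hj' : (Measure.pi fun _ : Fin n => W.jointLaw).map (fun p => p j) = W.jointLaw :=
      hj.map_eq
    have hmeas : Measurable fun p : Fin n → ℤˣ × ℝ => (p i, p j) := by fun_prop
    have hS : MeasurableSet {q : (ℤˣ × ℝ) × (ℤˣ × ℝ) | W.absLLR q.1.2 = W.absLLR q.2.2} :=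
      measurableSet_eq_fun (W.measurable_absLLR.comp (by fun_prop))
        (W.measurable_absLLR.comp (by fun_prop))
    have hnull : ((Measure.pi fun _ : Fin n => W.jointLaw).map fun p => (p i, p j))
        {q | W.absLLR q.1.2 = W.absLLR q.2.2} = 0 := by
      rw [hmap, hi', hj', Measure.measure_prod_null hS]
      refine Filter.Eventually.of_forall fun q => ?_
      refine (congrArg W.jointLaw ?_).trans (hW (W.absLLR q.2))
      ext p
      exact eq_comm
    rw [Measure.map_apply hmeas hS] at hnull
    rw [ae_iff]
    simpa using hnull
  have hall := ae_all_iff.2 fun i => ae_all_iff.2 fun j => ae_all_iff.2 (hpair i j)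
  filter_upwards [hall] with p hp i j hij
  by_contra h
  exact hp i j h hij

variable {W} in
/-- Sorting `n` independent pairs gives the restriction of their law to the descending sequences,
multiplied by `n!`. -/
theorem ContinuousLLR.map_descSort (hW : W.ContinuousLLR) (n : ℕ) :
    (Measure.pi fun _ : Fin n => W.jointLaw).map W.descSort =
      (n.factorial : ℝ≥0∞) •
        (Measure.pi fun _ : Fin n => W.jointLaw).restrict (W.descending (Fin n)) := by
  set P := Measure.pi fun _ : Fin n => W.jointLaw
  ext s hs
  rw [Measure.map_apply W.measurable_descSort hs, Measure.smul_apply, Measure.restrict_apply hs]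
  -- Permuting coordinates preserves `P`, and off the null set of ties the event of order `σ` is the
  -- preimage of the descending set.
  have hterm : ∀ σ : Equiv.Perm (Fin n),
      P ({p | W.order (fun i => (p i).2) = σ} ∩ (fun p i => p (σ i)) ⁻¹' s) =
        P (s ∩ W.descending (Fin n)) := by
    intro σ
    rw [← (measurePreserving_comp_perm W.jointLaw σ).measure_preimage
      (hs.inter (W.measurableSet_descending _)).nullMeasurableSet]
    refine measure_congr ?_
    filter_upwards [hW.ae_injective n] with p hp
    refine propext ?_
    change (W.order (fun i => (p i).2) = σ ∧ _) ↔ (_ ∧ Antitone fun i => W.absLLR (p (σ i)).2)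
    rw [order_eq_iff, and_comm]
    refine and_congr Iff.rfl ⟨fun h => h.1, fun h => ⟨h, fun i j hij he => ?_⟩⟩
    exact absurd (σ.injective (hp he)) hij.ne
  rw [descSort_preimage, measure_iUnion]
  · simp_rw [hterm]
    rw [tsum_fintype, Finset.sum_const, Finset.card_univ, Fintype.card_perm, Fintype.card_fin,
      nsmul_eq_mul, smul_eq_mul]
  · intro σ τ hστ
    refine Set.disjoint_left.2 fun p hp hp' => hστ ?_
    exact hp.1.symm.trans hp'.1
  · exact fun σ => (W.measurableSet_order_eq σ).inter
      (measurable_pi_lambda _ (fun i => measurable_pi_apply _) hs)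

variable {W} in
/-- The integral of a symmetric function is `n!` times its integral over the descending
sequences. -/
theorem ContinuousLLR.lintegral_eq_factorial_mul (hW : W.ContinuousLLR) {n : ℕ}
    {k : (Fin n → ℤˣ × ℝ) → ℝ≥0∞} (hk : Measurable k)
    (hsymm : ∀ p, (Function.Injective fun i => W.absLLR (p i).2) →
      ∀ σ : Equiv.Perm (Fin n), k (fun i => p (σ i)) = k p) :
    ∫⁻ p, k p ∂(Measure.pi fun _ : Fin n => W.jointLaw) =
      n.factorial * ∫⁻ p in W.descending (Fin n), k p ∂(Measure.pi fun _ => W.jointLaw) := by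
  rw [← smul_eq_mul, ← lintegral_smul_measure, ← hW.map_descSort n,
    lintegral_map hk W.measurable_descSort]
  refine lintegral_congr_ae ?_
  filter_upwards [hW.ae_injective n] with p hp
  exact (hsymm p hp _).symm

end SymmetricChannel

/-! ### Splitting a sequence into the segment and the outside entries. -/

/-- The positions outside the segment `a, …, b`, counted from `1`. -/
abbrev OutsideSegment (n a b : ℕ) : Type := {i : Fin n // ¬ (a - 1 ≤ (i : ℕ) ∧ (i : ℕ) < b)}

/-- The positions in the segment `a, …, b`, numbered in increasing order. -/
def segmentEquiv {n a b : ℕ} (ha : 1 ≤ a) (hb : b ≤ n) :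
    Fin (b + 1 - a) ≃ {i : Fin n // a - 1 ≤ (i : ℕ) ∧ (i : ℕ) < b} where
  toFun j := ⟨⟨a - 1 + j, by omega⟩, by dsimp only; omega⟩
  invFun i := ⟨i.1 - (a - 1), by have := i.2; omega⟩
  left_inv j := by ext; simp
  right_inv i := by ext; have := i.2; dsimp only; omega

/-- The positions in the segment `a, …, b` together with the remaining ones. -/
def segmentSumEquiv {n a b : ℕ} (ha : 1 ≤ a) (hb : b ≤ n) :
    Fin (b + 1 - a) ⊕ OutsideSegment n a b ≃ Fin n :=
  ((segmentEquiv ha hb).sumCongr (Equiv.refl _)).trans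
    (Equiv.sumCompl fun i : Fin n => a - 1 ≤ (i : ℕ) ∧ (i : ℕ) < b)

@[simp] theorem segmentSumEquiv_inl {n a b : ℕ} (ha : 1 ≤ a) (hb : b ≤ n)
    (j : Fin (b + 1 - a)) :
    segmentSumEquiv ha hb (Sum.inl j) = ⟨a - 1 + j, by omega⟩ := rfl

@[simp] theorem segmentSumEquiv_inr {n a b : ℕ} (ha : 1 ≤ a) (hb : b ≤ n)
    (i : OutsideSegment n a b) : segmentSumEquiv ha hb (Sum.inr i) = i.1 := rfl

/-- The sequence with the entries `q` in the segment and `r` outside. -/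
def glueSegment {E : Type*} {n a b : ℕ} (ha : 1 ≤ a) (hb : b ≤ n)
    (q : Fin (b + 1 - a) → E) (r : OutsideSegment n a b → E) : Fin n → E :=
  fun i => Sum.elim q r ((segmentSumEquiv ha hb).symm i)

theorem glueSegment_inside {E : Type*} {n a b : ℕ} (ha : 1 ≤ a) (hb : b ≤ n)
    (q : Fin (b + 1 - a) → E) (r : OutsideSegment n a b → E) (j : Fin (b + 1 - a)) :
    glueSegment ha hb q r ⟨a - 1 + j, by omega⟩ = q j := by
  rw [← segmentSumEquiv_inl ha hb, glueSegment, Equiv.symm_apply_apply, Sum.elim_inl]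

theorem glueSegment_outside {E : Type*} {n a b : ℕ} (ha : 1 ≤ a) (hb : b ≤ n)
    (q : Fin (b + 1 - a) → E) (r : OutsideSegment n a b → E) (i : OutsideSegment n a b) :
    glueSegment ha hb q r i.1 = r i := by
  rw [← segmentSumEquiv_inr ha hb, glueSegment, Equiv.symm_apply_apply, Sum.elim_inr]

theorem measurePreserving_glueSegment {E : Type*} [MeasurableSpace E] (ρ : Measure E)
    [SigmaFinite ρ] {n a b : ℕ} (ha : 1 ≤ a) (hb : b ≤ n) :
    MeasurePreserving
      (fun t : (Fin (b + 1 - a) → E) × (OutsideSegment n a b → E) => glueSegment ha hb t.1 t.2)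
      ((Measure.pi fun _ => ρ).prod (Measure.pi fun _ => ρ)) (Measure.pi fun _ => ρ) := by
  have h := (measurePreserving_piCongrLeft (fun _ : Fin n => ρ) (segmentSumEquiv ha hb)).comp
    (measurePreserving_sumPiEquivProdPi_symm
      (fun _ : Fin (b + 1 - a) ⊕ OutsideSegment n a b => ρ))
  convert h using 1
  ext t i : 2
  obtain ⟨s, rfl⟩ := (segmentSumEquiv ha hb).surjective i
  rw [Function.comp_apply, MeasurableEquiv.coe_piCongrLeft, Equiv.piCongrLeft_apply_apply,
    glueSegment, Equiv.symm_apply_apply]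
  cases s <;> rfl

/-! ### Joint law of the boundary magnitudes and the ordered segment. -/

namespace SymmetricChannel

variable (W : SymmetricChannel)

/-- The LLR magnitude at position `i`, where the positions are `1, …, n`, extended by `∞` at
position `0` and by `0` at position `n + 1`. -/
def absLLRAt {n : ℕ} (p : Fin n → ℤˣ × ℝ) (i : ℕ) : ℝ≥0∞ :=
  if i = 0 then ⊤ else if h : i - 1 < n then W.absLLR (p ⟨i - 1, h⟩).2 else 0

theorem measurable_absLLRAt {n : ℕ} (i : ℕ) :
    Measurable fun p : Fin n → ℤˣ × ℝ => W.absLLRAt p i := by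
  unfold absLLRAt
  split_ifs
  · exact measurable_const
  · exact W.measurable_absLLR_apply _
  · exact measurable_const

/-- The LLR magnitudes at the ordered positions `a - 1` and `b + 1`. -/
def boundary {n : ℕ} (a b : ℕ) (p : Fin n → ℤˣ × ℝ) : ℝ≥0∞ × ℝ≥0∞ :=
  (W.orderedAbsLLR (fun j => (p j).2) (a - 1), W.orderedAbsLLR (fun j => (p j).2) (b + 1))

theorem measurable_boundary {n : ℕ} (a b : ℕ) : Measurable (W.boundary (n := n) a b) := by
  have h : W.boundary (n := n) a b = fun p =>
      (W.absLLRAt (W.descSort p) (a - 1), W.absLLRAt (W.descSort p) (b + 1)) := rfl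
  rw [h]
  exact ((W.measurable_absLLRAt (a - 1)).comp W.measurable_descSort).prodMk
    ((W.measurable_absLLRAt (b + 1)).comp W.measurable_descSort)

theorem measurable_orderedSegment {n a b : ℕ} (ha : 1 ≤ a) (hb : b ≤ n) :
    Measurable (W.orderedSegment ha hb) :=
  measurable_pi_lambda _ fun j =>
    (measurable_pi_apply (⟨a - 1 + j, by omega⟩ : Fin n)).comp W.measurable_descSort

/-- The LLR magnitudes at the positions `a - 1` and `b + 1`, as a function of the entries outside
the segment `a, …, b`. -/
def outerBoundary {n a b : ℕ} (ha : 1 ≤ a) (hb : b ≤ n)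
    (r : OutsideSegment n a b → ℤˣ × ℝ) : ℝ≥0∞ × ℝ≥0∞ :=
  (W.absLLRAt (glueSegment ha hb (fun _ => (1, 0)) r) (a - 1),
    W.absLLRAt (glueSegment ha hb (fun _ => (1, 0)) r) (b + 1))

theorem absLLRAt_glueSegment_left {n a b : ℕ} (ha : 1 ≤ a) (hab : a ≤ b) (hb : b ≤ n)
    (q : Fin (b + 1 - a) → ℤˣ × ℝ) (r : OutsideSegment n a b → ℤˣ × ℝ) :
    W.absLLRAt (glueSegment ha hb q r) (a - 1) =
      if h : a - 1 = 0 then ⊤ else W.absLLR (r ⟨⟨a - 1 - 1, by omega⟩, by dsimp only; omega⟩).2 := by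
  unfold absLLRAt
  split_ifs with h h'
  · rfl
  · rw [← glueSegment_outside ha hb q r]
  · omega

theorem absLLRAt_glueSegment_right {n a b : ℕ} (ha : 1 ≤ a) (hb : b ≤ n)
    (q : Fin (b + 1 - a) → ℤˣ × ℝ) (r : OutsideSegment n a b → ℤˣ × ℝ) :
    W.absLLRAt (glueSegment ha hb q r) (b + 1) =
      if h : b < n then W.absLLR (r ⟨⟨b, h⟩, by dsimp only; omega⟩).2 else 0 := by
  unfold absLLRAt
  rw [if_neg (Nat.succ_ne_zero b)]
  simp only [Nat.add_sub_cancel]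
  split_ifs with h
  · rw [← glueSegment_outside ha hb q r]
  · rfl

/-- Positions `a - 1` and `b + 1` lie outside the segment or off the sequence, so the segment
entries, including the filler in `outerBoundary`, are never read. -/
theorem absLLRAt_glueSegment {n a b : ℕ} (ha : 1 ≤ a) (hab : a ≤ b) (hb : b ≤ n)
    (q : Fin (b + 1 - a) → ℤˣ × ℝ) (r : OutsideSegment n a b → ℤˣ × ℝ) :
    (W.absLLRAt (glueSegment ha hb q r) (a - 1), W.absLLRAt (glueSegment ha hb q r) (b + 1)) =
      W.outerBoundary ha hb r := by
  simp only [outerBoundary, W.absLLRAt_glueSegment_left ha hab hb,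
    W.absLLRAt_glueSegment_right ha hb]

/-- The sequences of pairs whose LLR magnitudes all lie between `v` and `u`. -/
def bandBox (m : ℕ) (u v : ℝ≥0∞) : Set (Fin m → ℤˣ × ℝ) :=
  Set.univ.pi fun _ => Prod.snd ⁻¹' W.band u v

theorem mem_bandBox {m : ℕ} {u v : ℝ≥0∞} {q : Fin m → ℤˣ × ℝ} :
    q ∈ W.bandBox m u v ↔ ∀ j, v ≤ W.absLLR (q j).2 ∧ W.absLLR (q j).2 ≤ u := by
  simp [bandBox, band_eq]

theorem measurableSet_bandBox (m : ℕ) (u v : ℝ≥0∞) : MeasurableSet (W.bandBox m u v) :=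
  MeasurableSet.univ_pi fun _ => measurable_snd (W.measurableSet_band u v)

/-- When the outside entries descend, the segment need only be compared with its two nearest
neighbours; the values `∞` and `0` make this vacuous at the ends. The parts thus interact only
through the boundary. -/
theorem glueSegment_mem_descending {n a b : ℕ} (ha : 1 ≤ a) (hab : a ≤ b) (hb : b ≤ n)
    (q : Fin (b + 1 - a) → ℤˣ × ℝ) (r : OutsideSegment n a b → ℤˣ × ℝ) :
    glueSegment ha hb q r ∈ W.descending (Fin n) ↔
      r ∈ W.descending (OutsideSegment n a b) ∧ q ∈ W.descending (Fin (b + 1 - a)) ∩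
        W.bandBox (b + 1 - a) (W.outerBoundary ha hb r).1 (W.outerBoundary ha hb r).2 := by
  have hU := W.absLLRAt_glueSegment_left ha hab hb (fun _ => (1, 0)) r
  have hV := W.absLLRAt_glueSegment_right ha hb (fun _ => (1, 0)) r
  rw [Set.mem_inter_iff, mem_bandBox]
  simp only [outerBoundary, hU, hV]
  constructor
  · intro h
    refine ⟨fun i i' hii => ?_, fun j j' hjj => ?_, fun j => ⟨?_, ?_⟩⟩
    · dsimp only
      rw [← glueSegment_outside ha hb q r i, ← glueSegment_outside ha hb q r i']
      exact h hii
    · dsimp only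
      rw [← glueSegment_inside ha hb q r j, ← glueSegment_inside ha hb q r j']
      exact h (Fin.mk_le_mk.2 (Nat.add_le_add_left hjj _))
    · split_ifs with hbn
      · rw [← glueSegment_inside ha hb q r j, ← glueSegment_outside ha hb q r]
        exact h (Fin.mk_le_mk.2 (by omega))
      · exact zero_le
    · split_ifs with h0
      · exact le_top
      · rw [← glueSegment_inside ha hb q r j, ← glueSegment_outside ha hb q r]
        exact h (Fin.mk_le_mk.2 (by omega))
  · rintro ⟨hr, hq, hB⟩ i i' hii
    obtain ⟨s, rfl⟩ := (segmentSumEquiv ha hb).surjective i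
    obtain ⟨s', rfl⟩ := (segmentSumEquiv ha hb).surjective i'
    dsimp only
    rcases s with j | i <;> rcases s' with j' | i' <;>
      simp only [segmentSumEquiv_inl, segmentSumEquiv_inr, glueSegment_inside,
        glueSegment_outside] at hii ⊢
    · exact hq (by rw [Fin.mk_le_mk] at hii; rw [Fin.le_def]; omega)
    · have hi' : a - 1 + (j : ℕ) ≤ (i'.1 : ℕ) := hii
      have hbi : b ≤ (i'.1 : ℕ) := by have := i'.2; omega
      have hbn : b < n := hbi.trans_lt i'.1.2
      have h := (hB j).1
      rw [dif_pos hbn] at h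
      refine le_trans (hr ?_) h
      exact hbi
    · have hi' : (i.1 : ℕ) ≤ a - 1 + (j' : ℕ) := hii
      have hia : (i.1 : ℕ) < a - 1 := by have := i.2; have := j'.2; omega
      have h := (hB j').2
      rw [dif_neg (by omega)] at h
      refine le_trans h (hr ?_)
      change (i.1 : ℕ) ≤ a - 1 - 1
      omega
    · exact hr hii

variable {W} in
/-- The joint law of the boundary magnitudes and the ordered segment, as an iterated integral:
given the entries outside the segment, those inside range over the descending sequences in the
band. -/
theorem ContinuousLLR.lintegral_boundary_segment (hW : W.ContinuousLLR) {n a b : ℕ} (ha : 1 ≤ a)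
    (hab : a ≤ b) (hb : b ≤ n)
    {H : (ℝ≥0∞ × ℝ≥0∞) × (Fin (b + 1 - a) → ℤˣ × ℝ) → ℝ≥0∞} (hH : Measurable H) :
    ∫⁻ p, H (W.boundary a b p, W.orderedSegment ha hb p) ∂(Measure.pi fun _ => W.jointLaw) =
      n.factorial * ∫⁻ r in W.descending (OutsideSegment n a b),
        ∫⁻ q in W.descending (Fin (b + 1 - a)) ∩
            W.bandBox (b + 1 - a) (W.outerBoundary ha hb r).1 (W.outerBoundary ha hb r).2,
          H (W.outerBoundary ha hb r, q) ∂(Measure.pi fun _ => W.jointLaw)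
        ∂(Measure.pi fun _ => W.jointLaw) := by
  set K : (Fin n → ℤˣ × ℝ) → ℝ≥0∞ := fun p =>
    H ((W.absLLRAt p (a - 1), W.absLLRAt p (b + 1)), fun j => p ⟨a - 1 + j, by omega⟩) with hK
  have hKm : Measurable K := by
    refine hH.comp (((W.measurable_absLLRAt _).prodMk (W.measurable_absLLRAt _)).prodMk ?_)
    exact measurable_pi_lambda _ fun j => measurable_pi_apply _
  have hKg : ∀ q r, K (glueSegment ha hb q r) = H (W.outerBoundary ha hb r, q) := by
    intro q r
    simp only [hK, W.absLLRAt_glueSegment ha hab hb, glueSegment_inside]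
  have hglue := measurePreserving_glueSegment W.jointLaw ha hb
  have hDm := W.measurableSet_descending (Fin n)
  calc _ = ∫⁻ p, K p ∂((Measure.pi fun _ : Fin n => W.jointLaw).map W.descSort) :=
        (lintegral_map hKm W.measurable_descSort).symm
    _ = n.factorial * ∫⁻ p, (W.descending (Fin n)).indicator K p
          ∂(Measure.pi fun _ => W.jointLaw) := by
        rw [hW.map_descSort, lintegral_smul_measure, lintegral_indicator hDm, smul_eq_mul]
    _ = _ := by
        congr 1
        rw [← hglue.lintegral_comp (hKm.indicator hDm)]
        -- Fubini with the outside entries as outer variable, so that the band is fixed in the inner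
        -- integral.
        refine (lintegral_prod_symm _
          ((hKm.indicator hDm).comp hglue.measurable).aemeasurable).trans ?_
        rw [← lintegral_indicator (W.measurableSet_descending _)]
        refine lintegral_congr fun r => ?_
        by_cases hr : r ∈ W.descending (OutsideSegment n a b)
        · rw [Set.indicator_of_mem hr, ← lintegral_indicator
            ((W.measurableSet_descending _).inter (W.measurableSet_bandBox _ _ _))]
          refine lintegral_congr fun q => ?_
          rw [Function.comp_apply]
          by_cases hq : q ∈ W.descending (Fin (b + 1 - a)) ∩
            W.bandBox (b + 1 - a) (W.outerBoundary ha hb r).1 (W.outerBoundary ha hb r).2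
          · rw [Set.indicator_of_mem hq, Set.indicator_of_mem
              ((W.glueSegment_mem_descending ha hab hb q r).2 ⟨hr, hq⟩), hKg]
          · rw [Set.indicator_of_notMem hq, Set.indicator_of_notMem
              fun h => hq ((W.glueSegment_mem_descending ha hab hb q r).1 h).2]
        · rw [Set.indicator_of_notMem hr]
          refine (lintegral_congr fun q => ?_).trans lintegral_zero
          exact Set.indicator_of_notMem
            (fun h => hr ((W.glueSegment_mem_descending ha hab hb q r).1 h).1) _

theorem measurable_bandMass : Measurable fun z : ℝ≥0∞ × ℝ≥0∞ => W.bandMass z.1 z.2 := by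
  have hS : MeasurableSet {t : (ℝ≥0∞ × ℝ≥0∞) × (ℤˣ × ℝ) |
      t.1.2 ≤ W.absLLR t.2.2 ∧ W.absLLR t.2.2 ≤ t.1.1} := by
    have hf : Measurable fun t : (ℝ≥0∞ × ℝ≥0∞) × (ℤˣ × ℝ) => W.absLLR t.2.2 :=
      W.measurable_absLLR.comp (by fun_prop)
    exact (measurableSet_le (by fun_prop) hf).inter (measurableSet_le hf (by fun_prop))
  convert measurable_measure_prodMk_left (ν := W.jointLaw) hS using 2 with z
  rw [bandMass, band_eq]
  rfl

theorem measure_pi_bandBox (m : ℕ) (u v : ℝ≥0∞) :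
    (Measure.pi fun _ : Fin m => W.jointLaw) (W.bandBox m u v) = W.bandMass u v ^ m := by
  rw [bandBox, Measure.pi_pi, Finset.prod_const, Finset.card_univ, Fintype.card_fin, bandMass]

theorem comp_perm_mem_bandBox {m : ℕ} {u v : ℝ≥0∞} (q : Fin m → ℤˣ × ℝ)
    (σ : Equiv.Perm (Fin m)) :
    (fun i => q (σ i)) ∈ W.bandBox m u v ↔ q ∈ W.bandBox m u v := by
  simp only [mem_bandBox]
  exact σ.forall_congr_right (q := fun j => v ≤ W.absLLR (q j).2 ∧ W.absLLR (q j).2 ≤ u)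

variable {W} in
-- The box is permutation invariant, so its descending part carries the share `1 / m!` of its mass.
-- This fixes the constant in `segmentDensity`.
theorem ContinuousLLR.factorial_mul_measure_descending_inter_bandBox (hW : W.ContinuousLLR)
    (m : ℕ) (u v : ℝ≥0∞) :
    m.factorial * (Measure.pi fun _ => W.jointLaw) (W.descending (Fin m) ∩ W.bandBox m u v) =
      W.bandMass u v ^ m := by
  have hB := W.measurableSet_bandBox m u v
  have h := hW.lintegral_eq_factorial_mul (k := (W.bandBox m u v).indicator 1)
    (measurable_one.indicator hB) fun p _ σ => by
      classical
      simp only [Set.indicator_apply, comp_perm_mem_bandBox, Pi.one_apply]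
  rw [lintegral_indicator_one hB, lintegral_indicator_one hB, Measure.restrict_apply hB,
    measure_pi_bandBox, Set.inter_comm] at h
  exact h.symm

/-- The density, with respect to the law of `m` independent pairs, of the ordered segment given
the boundary magnitudes. -/
def segmentDensity (m : ℕ) (z : ℝ≥0∞ × ℝ≥0∞) : (Fin m → ℤˣ × ℝ) → ℝ≥0∞ :=
  (W.descending (Fin m) ∩ W.bandBox m z.1 z.2).indicator
    fun _ => m.factorial * (W.bandMass z.1 z.2)⁻¹ ^ m

theorem measurable_segmentDensity (m : ℕ) :
    Measurable (Function.uncurry (W.segmentDensity m)) := by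
  have hS : MeasurableSet {t : (ℝ≥0∞ × ℝ≥0∞) × (Fin m → ℤˣ × ℝ) |
      t.2 ∈ W.descending (Fin m) ∩ W.bandBox m t.1.1 t.1.2} := by
    have : {t : (ℝ≥0∞ × ℝ≥0∞) × (Fin m → ℤˣ × ℝ) |
        t.2 ∈ W.descending (Fin m) ∩ W.bandBox m t.1.1 t.1.2} =
        Prod.snd ⁻¹' W.descending (Fin m) ∩
          ⋂ j, {t | t.1.2 ≤ W.absLLR (t.2 j).2 ∧ W.absLLR (t.2 j).2 ≤ t.1.1} := by
      ext t
      simp [mem_bandBox]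
    rw [this]
    refine (measurable_snd (W.measurableSet_descending _)).inter (.iInter fun j => ?_)
    have hf : Measurable fun t : (ℝ≥0∞ × ℝ≥0∞) × (Fin m → ℤˣ × ℝ) => W.absLLR (t.2 j).2 :=
      W.measurable_absLLR.comp (by fun_prop)
    exact (measurableSet_le (by fun_prop) hf).inter (measurableSet_le hf (by fun_prop))
  have hc : Measurable fun t : (ℝ≥0∞ × ℝ≥0∞) × (Fin m → ℤˣ × ℝ) =>
      (m.factorial : ℝ≥0∞) * (W.bandMass t.1.1 t.1.2)⁻¹ ^ m :=
    ((W.measurable_bandMass.comp measurable_fst).inv.pow_const m).const_mul _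
  exact hc.indicator hS

/-- The conditional law of the ordered segment given the boundary magnitudes. -/
def segmentKernel (m : ℕ) : Kernel (ℝ≥0∞ × ℝ≥0∞) (Fin m → ℤˣ × ℝ) :=
  (Kernel.const _ (Measure.pi fun _ : Fin m => W.jointLaw)).withDensity (W.segmentDensity m)

theorem segmentKernel_apply (m : ℕ) (z : ℝ≥0∞ × ℝ≥0∞) :
    W.segmentKernel m z = ((m.factorial : ℝ≥0∞) * (W.bandMass z.1 z.2)⁻¹ ^ m) •
      (Measure.pi fun _ => W.jointLaw).restrict
        (W.descending (Fin m) ∩ W.bandBox m z.1 z.2) := by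
  have hm := (W.measurableSet_descending (Fin m)).inter (W.measurableSet_bandBox m z.1 z.2)
  rw [segmentKernel, Kernel.withDensity_apply _ (W.measurable_segmentDensity m),
    Kernel.const_apply, segmentDensity, withDensity_indicator hm, withDensity_const]

variable {W} in
-- The total mass is `((bandMass)⁻¹ * bandMass) ^ m`, at most `1` even for zero band mass since `⊤ *
-- 0 = 0` in `ℝ≥0∞`.
theorem ContinuousLLR.isFiniteKernel_segmentKernel (hW : W.ContinuousLLR) (m : ℕ) :
    IsFiniteKernel (W.segmentKernel m) := by
  refine ⟨1, ENNReal.one_lt_top, fun z => ?_⟩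
  rw [segmentKernel_apply, Measure.smul_apply, Measure.restrict_apply_univ, smul_eq_mul, mul_assoc,
    mul_left_comm, hW.factorial_mul_measure_descending_inter_bandBox, ← mul_pow]
  exact pow_le_one₀ zero_le (ENNReal.inv_mul_le_one _)

variable {W} in
-- The segment is nonempty and must fall in the band, which is impossible with positive probability
-- when the band has no mass.
theorem ContinuousLLR.ae_bandMass_boundary_ne_zero (hW : W.ContinuousLLR) {n a b : ℕ}
    (ha : 1 ≤ a) (hab : a ≤ b) (hb : b ≤ n) :
    ∀ᵐ p ∂(Measure.pi fun _ : Fin n => W.jointLaw),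
      W.bandMass (W.boundary a b p).1 (W.boundary a b p).2 ≠ 0 := by
  have hS : MeasurableSet {z : ℝ≥0∞ × ℝ≥0∞ | W.bandMass z.1 z.2 = 0} :=
    W.measurable_bandMass (measurableSet_singleton 0)
  have hH : Measurable fun t : (ℝ≥0∞ × ℝ≥0∞) × (Fin (b + 1 - a) → ℤˣ × ℝ) =>
      {z : ℝ≥0∞ × ℝ≥0∞ | W.bandMass z.1 z.2 = 0}.indicator (1 : ℝ≥0∞ × ℝ≥0∞ → ℝ≥0∞) t.1 :=
    (measurable_one.indicator hS).comp measurable_fst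
  have h := hW.lintegral_boundary_segment ha hab hb hH
  have hzero : ∀ z : ℝ≥0∞ × ℝ≥0∞,
      ∫⁻ _ in W.descending (Fin (b + 1 - a)) ∩ W.bandBox (b + 1 - a) z.1 z.2,
        {z : ℝ≥0∞ × ℝ≥0∞ | W.bandMass z.1 z.2 = 0}.indicator (1 : ℝ≥0∞ × ℝ≥0∞ → ℝ≥0∞) z
        ∂(Measure.pi fun _ => W.jointLaw) = 0 := by
    intro z
    rw [setLIntegral_const]
    by_cases hz : W.bandMass z.1 z.2 = 0
    · have hb' := hW.factorial_mul_measure_descending_inter_bandBox (b + 1 - a) z.1 z.2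
      rw [hz, zero_pow (by omega), mul_eq_zero] at hb'
      rw [hb'.resolve_left (by exact_mod_cast Nat.factorial_ne_zero _), mul_zero]
    · have hz' : z ∉ {z : ℝ≥0∞ × ℝ≥0∞ | W.bandMass z.1 z.2 = 0} := hz
      rw [Set.indicator_of_notMem hz', zero_mul]
  simp only [hzero, lintegral_zero, mul_zero] at h
  have hae := (lintegral_eq_zero_iff
    ((measurable_one.indicator hS).comp (W.measurable_boundary a b))).1 h
  filter_upwards [hae] with p hp h0
  have h0' : W.boundary a b p ∈ {z : ℝ≥0∞ × ℝ≥0∞ | W.bandMass z.1 z.2 = 0} := h0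
  rw [Function.comp_apply, Set.indicator_of_mem h0'] at hp
  exact one_ne_zero hp

variable {W} in
theorem ContinuousLLR.measure_boundary_segment (hW : W.ContinuousLLR) {n a b : ℕ}
    (ha : 1 ≤ a) (hab : a ≤ b) (hb : b ≤ n)
    {s : Set ((ℝ≥0∞ × ℝ≥0∞) × (Fin (b + 1 - a) → ℤˣ × ℝ))} (hs : MeasurableSet s) :
    (Measure.pi fun _ : Fin n => W.jointLaw)
        {p | (W.boundary a b p, W.orderedSegment ha hb p) ∈ s} =
      ∫⁻ p, W.segmentKernel (b + 1 - a) (W.boundary a b p) (Prod.mk (W.boundary a b p) ⁻¹' s)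
        ∂(Measure.pi fun _ : Fin n => W.jointLaw) := by
  have := hW.isFiniteKernel_segmentKernel (b + 1 - a)
  have hpre : MeasurableSet {p : Fin n → ℤˣ × ℝ |
      (W.boundary a b p, W.orderedSegment ha hb p) ∈ s} :=
    ((W.measurable_boundary a b).prodMk (W.measurable_orderedSegment ha hb)) hs
  have hker : Measurable fun z => W.segmentKernel (b + 1 - a) z (Prod.mk z ⁻¹' s) :=
    Kernel.measurable_kernel_prodMk_left hs
  rw [← lintegral_indicator_one hpre]
  refine (hW.lintegral_boundary_segment ha hab hb (measurable_one.indicator hs)).trans ?_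
  -- The right-hand integrand depends on the boundary only, so its inner integral yields a factor `P
  -- B`, which cancels the kernel's normalization.
  refine Eq.trans ?_ (hW.lintegral_boundary_segment ha hab hb (hker.comp measurable_fst)).symm
  congr 1
  refine lintegral_congr fun r => ?_
  generalize W.outerBoundary ha hb r = z
  have hsz : MeasurableSet (Prod.mk z ⁻¹' s) := measurable_prodMk_left hs
  have hmass := hW.factorial_mul_measure_descending_inter_bandBox (b + 1 - a) z.1 z.2
  set B := W.descending (Fin (b + 1 - a)) ∩ W.bandBox (b + 1 - a) z.1 z.2
  set P := Measure.pi fun _ : Fin (b + 1 - a) => W.jointLaw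
  have hleft : ∫⁻ q in B, s.indicator 1 (z, q) ∂P = P.restrict B (Prod.mk z ⁻¹' s) := by
    rw [← lintegral_indicator_one hsz]
    rfl
  rw [hleft]
  simp only [Function.comp_apply]
  rw [setLIntegral_const, segmentKernel_apply, Measure.smul_apply, smul_eq_mul]
  change _ = (_ * (P.restrict B) (Prod.mk z ⁻¹' s)) * P B
  rcases eq_or_ne (W.bandMass z.1 z.2) 0 with h0 | h0
  · rw [h0, zero_pow (by omega), mul_eq_zero] at hmass
    have hPB : P B = 0 := hmass.resolve_left (by exact_mod_cast Nat.factorial_ne_zero _)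
    rw [Measure.restrict_eq_zero.2 hPB, hPB, mul_zero]
    rfl
  · rw [mul_right_comm, mul_right_comm (_ : ℝ≥0∞) (_ ^ _) (P B), hmass, ← mul_pow,
      ENNReal.mul_inv_cancel h0 (W.bandMass_ne_top _ _), one_pow, one_mul]

theorem pi_truncatedLaw (m : ℕ) {u v : ℝ≥0∞} (h : W.bandMass u v ≠ 0) :
    (Measure.pi fun _ : Fin m => W.truncatedLaw u v) =
      (W.bandMass u v)⁻¹ ^ m •
        (Measure.pi fun _ => W.jointLaw).restrict (W.bandBox m u v) := by
  have := W.isProbabilityMeasure_truncatedLaw h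
  refine (Measure.pi_eq fun s hs => ?_)
  rw [bandBox, Measure.restrict_pi_pi, Measure.smul_apply, Measure.pi_pi]
  simp only [W.truncatedLaw_eq, Measure.smul_apply, smul_eq_mul]
  rw [Finset.prod_mul_distrib, Finset.prod_const, Finset.card_univ, Fintype.card_fin]

end SymmetricChannel

/-! ### Posterior means and the symmetry of optimal guessing. -/

/-- Two bijections onto `{1, …, N}` that both list the elements in decreasing order of weight
yield the same weighted sums, however they break ties. -/
theorem sum_mul_eq_of_bijOn_of_decreasing {X : Type*} [Fintype X] {N : ℕ} {w : X → ℝ≥0∞}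
    {g₁ g₂ : X → ℕ} (h₁ : Set.BijOn g₁ Set.univ (Set.Icc 1 N))
    (h₂ : Set.BijOn g₂ Set.univ (Set.Icc 1 N))
    (hw₁ : ∀ x x', w x' < w x → g₁ x < g₁ x') (hw₂ : ∀ x x', w x' < w x → g₂ x < g₂ x')
    (φ : ℕ → ℝ≥0∞) : ∑ x, w x * φ (g₁ x) = ∑ x, w x * φ (g₂ x) := by
  have key : ∀ g : X → ℕ, Set.BijOn g Set.univ (Set.Icc 1 N) →
      (∀ x x', w x' < w x → g x < g x') →
      ∃ e : X ≃ Fin N, Antitone (w ∘ e.symm) ∧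
        ∑ x, w x * φ (g x) = ∑ k, (w ∘ e.symm) k * φ (k + 1) := by
    intro g hg hw
    have hmem : ∀ x, 1 ≤ g x ∧ g x ≤ N := fun x => hg.mapsTo (Set.mem_univ x)
    -- Guesses are numbered from `1`, the elements of `Fin N` from `0`.
    let e : X ≃ Fin N := Equiv.ofBijective
      (fun x => (⟨g x - 1, by have := hmem x; omega⟩ : Fin N)) <| by
        constructor
        · intro x x' hxx
          have h := Fin.mk.inj hxx
          refine hg.injOn (Set.mem_univ x) (Set.mem_univ x') ?_
          have := hmem x
          have := hmem x'
          omega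
        · intro k
          obtain ⟨x, -, hx⟩ := hg.surjOn (show (k : ℕ) + 1 ∈ Set.Icc 1 N from
            ⟨by omega, by omega⟩)
          refine ⟨x, Fin.ext ?_⟩
          simp [hx]
    have he : ∀ x, (e x : ℕ) + 1 = g x := fun x => Nat.sub_add_cancel (hmem x).1
    refine ⟨e, fun k k' hk => ?_, ?_⟩
    · by_contra! hlt
      have h := hw _ _ hlt
      rw [← he, ← he, Equiv.apply_symm_apply, Equiv.apply_symm_apply] at h
      have : (k : ℕ) ≤ k' := hk
      omega
    · rw [← Equiv.sum_comp e]
      simp [he]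
  obtain ⟨e₁, ha₁, hs₁⟩ := key g₁ h₁ hw₁
  obtain ⟨e₂, ha₂, hs₂⟩ := key g₂ h₂ hw₂
  -- Both lists are decreasing rearrangements of the same weights, hence equal even if ties are
  -- ordered differently.
  have h := Tuple.unique_antitone (f := w ∘ e₁.symm) (σ := Equiv.refl _) (τ := e₂.symm.trans e₁)
    ha₁ (by simpa [Function.comp_def] using ha₂)
  have h' : w ∘ e₁.symm = w ∘ e₂.symm := by
    ext k
    simpa using congrFun h k
  rw [hs₁, hs₂, h']

theorem MeasureTheory.lintegral_pi_prod {ι : Type*} [Fintype ι] {α : ι → Type*}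
    [∀ i, MeasurableSpace (α i)] (ν : ∀ i, Measure (α i)) [∀ i, IsProbabilityMeasure (ν i)]
    {f : ∀ i, α i → ℝ≥0∞} (hf : ∀ i, Measurable (f i)) :
    ∫⁻ y, ∏ i, f i (y i) ∂(Measure.pi ν) = ∏ i, ∫⁻ y, f i y ∂(ν i) := by
  have h := lintegral_prod_eq_prod_lintegral_of_indepFun Finset.univ
    (fun i (y : ∀ i, α i) => f i (y i))
    (iIndepFun_pi (μ := ν) fun i => (hf i).aemeasurable)
    fun i => (hf i).comp (measurable_pi_apply i)
  rw [h]
  exact Finset.prod_congr rfl fun i _ => (measurePreserving_eval ν i).lintegral_comp (hf i)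

theorem IsGuesswork.measurable_uncurry {m : ℕ} {G : (Fin m → ℤˣ) → (Fin m → ℝ) → ℕ}
    (hG : IsGuesswork G) :
    Measurable fun p : Fin m → ℤˣ × ℝ => G (fun i => (p i).1) (fun i => (p i).2) := by
  have h : Measurable fun t : (Fin m → ℤˣ) × (Fin m → ℝ) => G t.1 t.2 :=
    measurable_from_prod_countable_right hG.measurable
  have h' : Measurable fun p : Fin m → ℤˣ × ℝ => (fun i => (p i).1, fun i => (p i).2) :=
    (measurable_pi_lambda _ fun i => measurable_fst.comp (measurable_pi_apply i)).prodMk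
      (measurable_pi_lambda _ fun i => measurable_snd.comp (measurable_pi_apply i))
  exact h.comp h'

theorem measurable_prodMk_pi {m : ℕ} (x : Fin m → ℤˣ) :
    Measurable fun (y : Fin m → ℝ) i => (x i, y i) :=
  measurable_pi_lambda _ fun i => measurable_const.prodMk (measurable_pi_apply i)

namespace SymmetricChannel

variable (W : SymmetricChannel)

/-- The law of the channel output. -/
def outputLaw : Measure ℝ := volume.withDensity fun y => ∑ x, W.jointPdf x y

theorem measurable_sum_jointPdf : Measurable fun y => ∑ x, W.jointPdf x y :=
  Finset.measurable_fun_sum _ fun x _ => W.measurable_jointPdf x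

theorem lintegral_jointLaw {F : ℤˣ × ℝ → ℝ≥0∞} (hF : Measurable F) :
    ∫⁻ p, F p ∂W.jointLaw = ∑ x, ∫⁻ y, W.post x y * F (x, y) ∂W.outputLaw := by
  rw [jointLaw, lintegral_withDensity_eq_lintegral_mul _ W.measurable_uncurry_jointPdf hF,
    lintegral_count_intUnits_prod _ (W.measurable_uncurry_jointPdf.mul hF)]
  refine Finset.sum_congr rfl fun x _ => ?_
  have hFx : Measurable fun y => F (x, y) := hF.comp measurable_prodMk_left
  refine Eq.trans ?_ (lintegral_withDensity_eq_lintegral_mul _ W.measurable_sum_jointPdf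
    ((W.measurable_post x).mul hFx)).symm
  refine lintegral_congr fun y => ?_
  simp only [Pi.mul_apply]
  rw [← mul_assoc, mul_comm (∑ x, W.jointPdf x y), post_mul_sum_jointPdf]

instance isProbabilityMeasure_outputLaw : IsProbabilityMeasure W.outputLaw := by
  refine ⟨?_⟩
  rw [outputLaw, withDensity_apply _ .univ,
    lintegral_finsetSum _ fun x _ => W.measurable_jointPdf x,
    ← W.jointLaw_snd_preimage .univ, Set.preimage_univ, measure_univ]

/-- The posterior probability of an input sequence. -/
def seqPost {m : ℕ} (x : Fin m → ℤˣ) (y : Fin m → ℝ) : ℝ≥0∞ := ∏ i, W.post (x i) (y i)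

theorem measurable_seqPost {m : ℕ} (x : Fin m → ℤˣ) : Measurable (W.seqPost x) :=
  Finset.measurable_fun_prod _ fun i _ => (W.measurable_post (x i)).comp (measurable_pi_apply i)

/-- On a box, expanding the product of sums over single inputs gives a sum over input sequences. -/
theorem pi_jointLaw (m : ℕ) :
    (Measure.pi fun _ : Fin m => W.jointLaw) = ∑ x : Fin m → ℤˣ,
      ((Measure.pi fun _ => W.outputLaw).withDensity (W.seqPost x)).map
        fun y i => (x i, y i) := by
  classical
  refine Measure.pi_eq fun s hs => ?_
  have hslice : ∀ (i : Fin m) (x : ℤˣ), Measurable fun y =>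
      W.post x y * (s i).indicator 1 (x, y) := fun i x =>
    (W.measurable_post x).mul ((measurable_one.indicator (hs i)).comp measurable_prodMk_left)
  have hprod : ∀ i, W.jointLaw (s i) =
      ∑ x, ∫⁻ y, W.post x y * (s i).indicator 1 (x, y) ∂W.outputLaw := fun i => by
    rw [← lintegral_indicator_one (hs i), W.lintegral_jointLaw (measurable_one.indicator (hs i))]
  simp only [hprod]
  rw [Finset.prod_univ_sum, Fintype.piFinset_univ, Measure.finsetSum_apply]
  refine Finset.sum_congr rfl fun x _ => ?_
  have hbox : MeasurableSet ((fun (y : Fin m → ℝ) i => (x i, y i)) ⁻¹' Set.univ.pi s) :=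
    measurable_prodMk_pi x (MeasurableSet.univ_pi hs)
  rw [Measure.map_apply (measurable_prodMk_pi x) (MeasurableSet.univ_pi hs),
    withDensity_apply _ hbox, ← lintegral_pi_prod (fun _ => W.outputLaw) fun i => hslice i (x i),
    ← lintegral_indicator hbox]
  refine lintegral_congr fun y => ?_
  rw [Finset.prod_mul_distrib]
  by_cases hy : ∀ i, (x i, y i) ∈ s i
  · rw [Set.indicator_of_mem (by simpa using hy)]
    simp [hy, seqPost]
  · rw [Set.indicator_of_notMem (by simpa using hy)]
    push Not at hy
    obtain ⟨i, hi⟩ := hy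
    rw [Finset.prod_eq_zero (f := fun i => (s i).indicator 1 (x i, y i)) (Finset.mem_univ i)
      (Set.indicator_of_notMem hi _), mul_zero]

theorem lintegral_pi_jointLaw {m : ℕ} {F : (Fin m → ℤˣ × ℝ) → ℝ≥0∞} (hF : Measurable F) :
    ∫⁻ p, F p ∂(Measure.pi fun _ => W.jointLaw) =
      ∫⁻ y, ∑ x : Fin m → ℤˣ, W.seqPost x y * F (fun i => (x i, y i))
        ∂(Measure.pi fun _ => W.outputLaw) := by
  rw [pi_jointLaw, lintegral_finsetSum_measure, lintegral_finsetSum]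
  · refine Finset.sum_congr rfl fun x _ => ?_
    rw [lintegral_map hF (measurable_prodMk_pi x)]
    exact lintegral_withDensity_eq_lintegral_mul _ (W.measurable_seqPost x)
      (hF.comp (measurable_prodMk_pi x))
  · exact fun x _ => (W.measurable_seqPost x).mul (hF.comp (measurable_prodMk_pi x))

/-- The posterior mean of `φ` of the guesswork. -/
def postMean {m : ℕ} (G : (Fin m → ℤˣ) → (Fin m → ℝ) → ℕ) (φ : ℕ → ℝ≥0∞) (y : Fin m → ℝ) :
    ℝ≥0∞ :=
  ∑ x, W.seqPost x y * φ (G x y)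

theorem measurable_postMean {m : ℕ} {G : (Fin m → ℤˣ) → (Fin m → ℝ) → ℕ} (hG : IsGuesswork G)
    (φ : ℕ → ℝ≥0∞) : Measurable (W.postMean G φ) :=
  Finset.measurable_fun_sum _ fun x _ =>
    (W.measurable_seqPost x).mul ((measurable_of_countable φ).comp (hG.measurable x))

/-- The posteriors of the sequences sum to `1`, unless some output has zero density; then every
`seqPost` vanishes, and so does the mean. -/
theorem sum_seqPost_mul_postMean {m : ℕ} (G : (Fin m → ℤˣ) → (Fin m → ℝ) → ℕ)
    (φ : ℕ → ℝ≥0∞) (y : Fin m → ℝ) :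
    (∑ x, W.seqPost x y) * W.postMean G φ y = W.postMean G φ y := by
  classical
  have hsum : ∑ x, W.seqPost x y = ∏ i, ∑ x, W.post x (y i) := by
    rw [Finset.prod_univ_sum, Fintype.piFinset_univ]
    rfl
  by_cases h : ∃ i, ∑ x, W.post x (y i) = 0
  · obtain ⟨i, hi⟩ := h
    have hzero : W.postMean G φ y = 0 := by
      refine Finset.sum_eq_zero fun x _ => ?_
      rw [seqPost, Finset.prod_eq_zero (Finset.mem_univ i)
        (Finset.sum_eq_zero_iff.1 hi (x i) (Finset.mem_univ _)), zero_mul]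
    rw [hzero, mul_zero]
  · push Not at h
    rw [hsum, Finset.prod_eq_one fun i _ => (W.sum_post_eq_zero_or_one (y i)).resolve_left (h i),
      one_mul]

/-- Averaging over the inputs given the outputs, on an event that depends on the outputs only. -/
theorem setLIntegral_guesswork_eq_postMean {m : ℕ} {G : (Fin m → ℤˣ) → (Fin m → ℝ) → ℕ}
    (hG : IsGuesswork G) (φ : ℕ → ℝ≥0∞) {C : Set (Fin m → ℤˣ × ℝ)} (hC : MeasurableSet C)
    (hCy : ∀ p, p ∈ C ↔ (fun i => (1, (p i).2)) ∈ C) :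
    ∫⁻ p in C, φ (G (fun i => (p i).1) (fun i => (p i).2)) ∂(Measure.pi fun _ => W.jointLaw) =
      ∫⁻ p in C, W.postMean G φ (fun i => (p i).2) ∂(Measure.pi fun _ => W.jointLaw) := by
  have hφ : Measurable fun p : Fin m → ℤˣ × ℝ => φ (G (fun i => (p i).1) (fun i => (p i).2)) :=
    (measurable_of_countable φ).comp hG.measurable_uncurry
  have hmean : Measurable fun p : Fin m → ℤˣ × ℝ => W.postMean G φ (fun i => (p i).2) :=
    (W.measurable_postMean hG φ).comp
      (measurable_pi_lambda _ fun i => measurable_snd.comp (measurable_pi_apply i))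
  rw [← lintegral_indicator hC, ← lintegral_indicator hC, W.lintegral_pi_jointLaw (hφ.indicator hC),
    W.lintegral_pi_jointLaw (hmean.indicator hC)]
  refine lintegral_congr fun y => ?_
  by_cases hy : (fun i => ((1 : ℤˣ), y i)) ∈ C
  · have hx : ∀ x : Fin m → ℤˣ, (fun i => (x i, y i)) ∈ C := fun x => (hCy _).2 hy
    simp only [Set.indicator_of_mem (hx _)]
    rw [← Finset.sum_mul, sum_seqPost_mul_postMean]
    rfl
  · have hx : ∀ x : Fin m → ℤˣ, (fun i => (x i, y i)) ∉ C := fun x h => hy ((hCy _).1 h)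
    simp only [Set.indicator_of_notMem (hx _)]

variable {W} in
-- Permuting the outputs only relabels the posterior weights, and the mean depends on their
-- decreasing list alone, not on how ties are broken.
theorem postMean_comp_perm {m : ℕ} {G : (Fin m → ℤˣ) → (Fin m → ℝ) → ℕ} (hG : IsGuesswork G)
    (hopt : IsOptimal W G) (φ : ℕ → ℝ≥0∞) (y : Fin m → ℝ) (σ : Equiv.Perm (Fin m)) :
    W.postMean G φ (fun i => y (σ i)) = W.postMean G φ y := by
  have hw : ∀ x : Fin m → ℤˣ, W.seqPost (fun i => x (σ i)) (fun i => y (σ i)) = W.seqPost x y :=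
    fun x => Equiv.prod_comp σ fun i => W.post (x i) (y i)
  let e : (Fin m → ℤˣ) ≃ (Fin m → ℤˣ) := σ.symm.arrowCongr (Equiv.refl _)
  have he : ∀ x, e x = fun i => x (σ i) := fun x => rfl
  rw [postMean, ← Equiv.sum_comp e]
  simp only [he, hw]
  refine sum_mul_eq_of_bijOn_of_decreasing (N := 2 ^ m) ?_ (hG.bijOn y) ?_
    (fun x x' h => hopt x x' y h) φ
  · exact (hG.bijOn fun i => y (σ i)).comp (Set.bijOn_univ.2 e.bijective)
  · intro x x' h
    refine hopt _ _ _ ?_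
    exact (hw x').trans_lt (h.trans_eq (hw x).symm)

variable {W} in
/-- Over the sequences in a band, the guesswork integrates to `m!` times its integral over the
descending ones. -/
theorem ContinuousLLR.setLIntegral_guesswork (hW : W.ContinuousLLR) {m : ℕ}
    {G : (Fin m → ℤˣ) → (Fin m → ℝ) → ℕ} (hG : IsGuesswork G)
    (hG' : IsPermInvariant W G ∨ IsOptimal W G) (φ : ℕ → ℝ≥0∞) (u v : ℝ≥0∞) :
    ∫⁻ p in W.bandBox m u v, φ (G (fun i => (p i).1) (fun i => (p i).2))
        ∂(Measure.pi fun _ => W.jointLaw) =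
      m.factorial * ∫⁻ p in W.descending (Fin m) ∩ W.bandBox m u v,
        φ (G (fun i => (p i).1) (fun i => (p i).2)) ∂(Measure.pi fun _ => W.jointLaw) := by
  classical
  have hB := W.measurableSet_bandBox m u v
  have hD := W.measurableSet_descending (Fin m)
  have key : ∀ k : (Fin m → ℤˣ × ℝ) → ℝ≥0∞, Measurable k →
      (∀ p, (Function.Injective fun i => W.absLLR (p i).2) →
        ∀ σ : Equiv.Perm (Fin m), k (fun i => p (σ i)) = k p) →
      ∫⁻ p in W.bandBox m u v, k p ∂(Measure.pi fun _ => W.jointLaw) =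
        m.factorial * ∫⁻ p in W.descending (Fin m) ∩ W.bandBox m u v, k p
          ∂(Measure.pi fun _ => W.jointLaw) := by
    intro k hk hsymm
    rw [← lintegral_indicator hB, hW.lintegral_eq_factorial_mul (hk.indicator hB),
      lintegral_indicator hB, Measure.restrict_restrict hB, Set.inter_comm]
    intro p hp σ
    simp only [Set.indicator_apply, comp_perm_mem_bandBox, hsymm p hp σ]
  rcases hG' with hperm | hopt
  · exact key _ ((measurable_of_countable φ).comp hG.measurable_uncurry) fun p hp σ =>
      congrArg φ (hperm (fun i => (p i).1) (fun i => (p i).2) σ hp)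
  · have hBy : ∀ p, p ∈ W.bandBox m u v ↔ (fun i => (1, (p i).2)) ∈ W.bandBox m u v := fun p => by
      simp only [mem_bandBox]
    rw [W.setLIntegral_guesswork_eq_postMean hG φ hB hBy,
      W.setLIntegral_guesswork_eq_postMean hG φ (hD.inter hB)
        fun p => and_congr Iff.rfl (hBy p)]
    refine key _ ((W.measurable_postMean hG φ).comp
      (measurable_pi_lambda _ fun i => measurable_snd.comp (measurable_pi_apply i)))
      fun p _ σ => postMean_comp_perm hG hopt φ (fun i => (p i).2) σ

variable {W} in
-- Both laws are multiples of restrictions of the same product law; the extra `m!` in the kernel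
-- makes up for integrating over the descending part only.
theorem ContinuousLLR.guessMoment_truncatedLaw (hW : W.ContinuousLLR) {m : ℕ}
    {G : (Fin m → ℤˣ) → (Fin m → ℝ) → ℕ} (hG : IsGuesswork G)
    (hG' : IsPermInvariant W G ∨ IsOptimal W G) (ω : ℝ) {z : ℝ≥0∞ × ℝ≥0∞}
    (hz : W.bandMass z.1 z.2 ≠ 0) :
    guessMoment G ω (Measure.pi fun _ => W.truncatedLaw z.1 z.2) =
      guessMoment G ω (W.segmentKernel m z) := by
  have hmeas : Measurable fun p : Fin m → ℤˣ × ℝ =>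
      (G (fun i => (p i).1) (fun i => (p i).2) : ℝ) ^ ω :=
    (measurable_of_countable fun k : ℕ => (k : ℝ) ^ ω).comp hG.measurable_uncurry
  have hnonneg : ∀ p : Fin m → ℤˣ × ℝ,
      0 ≤ (G (fun i => (p i).1) (fun i => (p i).2) : ℝ) ^ ω :=
    fun p => Real.rpow_nonneg (Nat.cast_nonneg _) _
  rw [guessMoment, guessMoment,
    integral_eq_lintegral_of_nonneg_ae (.of_forall hnonneg) hmeas.aestronglyMeasurable,
    integral_eq_lintegral_of_nonneg_ae (.of_forall hnonneg) hmeas.aestronglyMeasurable,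
    W.pi_truncatedLaw m hz, segmentKernel_apply, lintegral_smul_measure, lintegral_smul_measure,
    hW.setLIntegral_guesswork hG hG' (fun k => ENNReal.ofReal ((k : ℝ) ^ ω)),
    smul_eq_mul, smul_eq_mul, mul_left_comm, mul_assoc]

end SymmetricChannel

/-! ### Identification of the conditional distribution and conclusion. -/

namespace SymmetricChannel

variable {W : SymmetricChannel} {Ω : Type*} [MeasurableSpace Ω] {μ : Measure Ω}

/-- `segmentKernel` is the conditional law of the ordered segment given the boundary magnitudes. -/
theorem ContinuousLLR.condDistrib_orderedSegment [IsFiniteMeasure μ] (hW : W.ContinuousLLR)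
    {n a b : ℕ} (ha : 1 ≤ a) (hab : a ≤ b) (hb : b ≤ n) {p : Ω → Fin n → ℤˣ × ℝ}
    (hp : Measurable p) (hlaw : μ.map p = Measure.pi fun _ => W.jointLaw) :
    condDistrib (fun w => W.orderedSegment ha hb (p w)) (fun w => W.boundary a b (p w)) μ
      =ᵐ[μ.map fun w => W.boundary a b (p w)] W.segmentKernel (b + 1 - a) := by
  have hfin := hW.isFiniteKernel_segmentKernel (b + 1 - a)
  have hZm : Measurable fun w => W.boundary a b (p w) := (W.measurable_boundary a b).comp hp
  have hSm : Measurable fun w => W.orderedSegment ha hb (p w) :=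
    (W.measurable_orderedSegment ha hb).comp hp
  -- Conditional distributions are almost everywhere unique, so it suffices to recover the joint law
  -- from the kernel.
  refine condDistrib_ae_eq_of_measure_eq_compProd _ hSm.aemeasurable ?_
  ext s hs
  have hker : Measurable fun z => W.segmentKernel (b + 1 - a) z (Prod.mk z ⁻¹' s) :=
    Kernel.measurable_kernel_prodMk_left hs
  have hpre : MeasurableSet {q : Fin n → ℤˣ × ℝ |
      (W.boundary a b q, W.orderedSegment ha hb q) ∈ s} :=
    ((W.measurable_boundary a b).prodMk (W.measurable_orderedSegment ha hb)) hs
  have hkerb : Measurable fun q : Fin n → ℤˣ × ℝ =>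
      W.segmentKernel (b + 1 - a) (W.boundary a b q) (Prod.mk (W.boundary a b q) ⁻¹' s) :=
    hker.comp (W.measurable_boundary a b)
  have h := hW.measure_boundary_segment ha hab hb hs
  rw [← hlaw, Measure.map_apply hp hpre, lintegral_map hkerb hp] at h
  rw [Measure.map_apply (hZm.prodMk hSm) hs, Measure.compProd_apply hs, lintegral_map hker hZm]
  exact h

theorem ContinuousLLR.ae_map_boundary_bandMass_ne_zero (hW : W.ContinuousLLR)
    {n a b : ℕ} (ha : 1 ≤ a) (hab : a ≤ b) (hb : b ≤ n) {p : Ω → Fin n → ℤˣ × ℝ}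
    (hp : Measurable p) (hlaw : μ.map p = Measure.pi fun _ => W.jointLaw) :
    ∀ᵐ z ∂(μ.map fun w => W.boundary a b (p w)), W.bandMass z.1 z.2 ≠ 0 := by
  have h := hW.ae_bandMass_boundary_ne_zero ha hab hb
  rw [← hlaw] at h
  have hZm : Measurable fun w => W.boundary a b (p w) := (W.measurable_boundary a b).comp hp
  refine (ae_map_iff hZm.aemeasurable
    (W.measurable_bandMass (measurableSet_singleton 0).compl)).2 ?_
  exact ae_of_ae_map hp.aemeasurable h

end SymmetricChannel

end

theorem lemma2 {Ω : Type*} [MeasurableSpace Ω] (μ : Measure Ω) [IsProbabilityMeasure μ]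
    (W : SymmetricChannel) (hW : W.ContinuousLLR)
    {n a b : ℕ} (ha : 1 ≤ a) (hab : a ≤ b) (hb : b ≤ n)
    (X : Fin n → Ω → ℤˣ) (Y : Fin n → Ω → ℝ)
    (hX : ∀ i, Measurable (X i)) (hY : ∀ i, Measurable (Y i))
    (hlaw : ∀ i, μ.map (fun w => (X i w, Y i w)) = W.jointLaw)
    (hindep : iIndepFun (fun i w => (X i w, Y i w)) μ) :
    -- almost every value `z = (|ℓ_{a-1}|, |ℓ_{b+1}|)` of the two boundary LLR magnitudes
    ∀ᵐ z ∂(μ.map fun w =>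
        (W.orderedAbsLLR (fun i => Y i w) (a - 1), W.orderedAbsLLR (fun i => Y i w) (b + 1))),
      IsProbabilityMeasure (W.truncatedLaw z.1 z.2) ∧
      ∀ (G : (Fin (b + 1 - a) → ℤˣ) → (Fin (b + 1 - a) → ℝ) → ℕ) (ω : ℝ),
        IsGuesswork G → (IsPermInvariant W G ∨ IsOptimal W G) →
          guessMoment G ω (Measure.pi fun _ => W.truncatedLaw z.1 z.2) =
          guessMoment G ω
            (condDistrib
              (fun w => W.orderedSegment ha hb fun i => (X i w, Y i w))
              (fun w => (W.orderedAbsLLR (fun i => Y i w) (a - 1),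
                W.orderedAbsLLR (fun i => Y i w) (b + 1)))
              μ z) := by
  have hpm : Measurable fun w i => (X i w, Y i w) :=
    measurable_pi_lambda _ fun i => (hX i).prodMk (hY i)
  have hplaw : μ.map (fun w i => (X i w, Y i w)) = Measure.pi fun _ => W.jointLaw := by
    rw [(iIndepFun_iff_map_fun_eq_pi_map fun i => ((hX i).prodMk (hY i)).aemeasurable).1 hindep]
    simp only [hlaw]
  have hcond := hW.condDistrib_orderedSegment ha hab hb hpm hplaw
  have hmass := hW.ae_map_boundary_bandMass_ne_zero ha hab hb hpm hplaw
  unfold SymmetricChannel.boundary at hcond hmass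
  -- The conditional laws themselves are identified, so the exceptional null set does not depend on
  -- `G` or `ω`.
  filter_upwards [hcond, hmass] with z hz hz0
  refine ⟨W.isProbabilityMeasure_truncatedLaw hz0, fun G ω hG hG' => ?_⟩
  rw [hz]
  exact hW.guessMoment_truncatedLaw hG hG' ω hz0
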